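/- There are universal constants $c_0, c', c_1, c_2 > 0$ such that the following holds. Let $n \ge 1$, let $M \in \mathbb{R}^{n\times n}$ be a matrix of rank $r$, and let $0 < p \le 1$ satisfy $p \ge c_0 \frac{\log n}{n}$. Let $\Omega \subseteq \{1,\dots,n\}^2$ be a random set containing each pair $(i,j)$ with probability $p$, independently of all other pairs, and let $\mathcal{P}_\Omega M$ be the matrix obtained from $M$ by setting the entries outside $\Omega$ to zero. Let $\widetilde M^\Omega$ be obtained from $\mathcal{P}_\Omega M$ by setting to zero all rows and all columns of $\mathcal{P}_\Omega M$ that have more than $2pn$ non-zero entries. For a singular value decomposition $\widetilde M^\Omega = \sum_{i=1}^n \tilde\sigma_i \tilde u_i \tilde v_i^\top$ with $\tilde\sigma_1 \ge \dots \ge \tilde\sigma_n \ge 0$ and orthonormal bases $(\tilde u_i)$, $(\tilde v_i)$ of $\mathbb{R}^n$, put $\mathsf{T}_r(\widetilde M^\Omega) := \frac1p \sum_{i=1}^r \tilde\sigma_i \tilde u_i \tilde v_i^\top$. Then, with probability at least $1 - c_1 n^{-c_2}$, $$\left\| M - \mathsf{T}_r(\widetilde M^\Omega) \right\|_F \le c'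 \left( \frac{\sqrt r \log n}{p} \|M\|_\infty + \sqrt{\frac{r \log n}{p}}\, \|M\|_{\infty,2} \right)$$ for every choice of the singular value decomposition of $\widetilde M^\Omega$. Here $\|\cdot\|_F$ is the Frobenius norm, $\|M\|_\infty := \max_{i,j} |M_{ij}|$, and $\|M\|_{\infty,2} := \max\bigl\{ \max_i (\sum_b M_{ib}^2)^{1/2},\ \max_j (\sum_a M_{aj}^2)^{1/2} \bigr\}$ is the largest Euclidean norm of a row or column of $M$. -/

import Mathlib

open MeasureTheory ProbabilityTheory

noncomputable section

namespace SVDProjection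

variable {n : ℕ}

/-- `Om` is a random set of index pairs in which every pair `(i, j)` is present with probability
`p`, independently of all the others. -/
structure IsBernoulliSample {S : Type*} [MeasurableSpace S] (P : Measure S) (p : ℝ)
    (Om : S → Set (Fin n × Fin n)) : Prop where
  measurableSet_mem : ∀ e, MeasurableSet {ω | e ∈ Om ω}
  indep : iIndepSet (fun e ↦ {ω | e ∈ Om ω}) P
  prob : ∀ e, P.real {ω | e ∈ Om ω} = p

open Classical in
/-- `𝒫_Ω M`: all the unobserved entries are set to zero. -/
def observe (Om : Set (Fin n × Fin n)) (M : Matrix (Fin n) (Fin n) ℝ) :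
    Matrix (Fin n) (Fin n) ℝ :=
  Matrix.of fun i j ↦ if (i, j) ∈ Om then M i j else 0

open Classical in
/-- The number of non-zero entries of row `i`. -/
def rowDegree (A : Matrix (Fin n) (Fin n) ℝ) (i : Fin n) : ℕ :=
  (Finset.univ.filter fun j ↦ A i j ≠ 0).card

open Classical in
/-- The number of non-zero entries of column `j`. -/
def colDegree (A : Matrix (Fin n) (Fin n) ℝ) (j : Fin n) : ℕ :=
  (Finset.univ.filter fun i ↦ A i j ≠ 0).card

open Classical in
/-- All rows and all columns of `A` whose degree in `A` is larger than `2pn` are set to zero. -/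
def trim (p : ℝ) (A : Matrix (Fin n) (Fin n) ℝ) : Matrix (Fin n) (Fin n) ℝ :=
  Matrix.of fun i j ↦
    if 2 * p * n < rowDegree A i ∨ 2 * p * n < colDegree A j then 0 else A i j

/-- A singular value decomposition `A = ∑ i, σ i • u i (v i)ᵀ` with the singular values in
decreasing order. -/
structure SVD (A : Matrix (Fin n) (Fin n) ℝ) where
  u : OrthonormalBasis (Fin n) ℝ (EuclideanSpace ℝ (Fin n))
  v : OrthonormalBasis (Fin n) ℝ (EuclideanSpace ℝ (Fin n))
  σ : Fin n → ℝ
  σ_nonneg : ∀ i, 0 ≤ σ i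
  σ_antitone : Antitone σ
  eq_sum : A = ∑ i, σ i • Matrix.vecMulVec (u i).ofLp (v i).ofLp

/-- The rescaled rank-`r` projection `(1/p) ∑_{i ≤ r} σ i • u i (v i)ᵀ`
(indices start at `0` here). -/
def SVD.proj {A : Matrix (Fin n) (Fin n) ℝ} (D : SVD A) (p : ℝ) (r : ℕ) :
    Matrix (Fin n) (Fin n) ℝ :=
  (1 / p) • ∑ i : Fin n with i.val < r, D.σ i • Matrix.vecMulVec (D.u i).ofLp (D.v i).ofLp

/-- Every square real matrix has a singular value decomposition. -/
theorem nonempty_svd (A : Matrix (Fin n) (Fin n) ℝ) : Nonempty (SVD A) := by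
  let T := Matrix.toEuclideanLin A
  have hn : Module.finrank ℝ (EuclideanSpace ℝ (Fin n)) = n := by simp
  have hS := T.isSymmetric_adjoint_comp_self
  set v := hS.eigenvectorBasis hn with hv
  set l := hS.eigenvalues hn with hl
  have hl0 : ∀ i, 0 ≤ l i := T.isPositive_adjoint_comp_self.nonneg_eigenvalues hn
  have hin : ∀ i j, inner ℝ (T (v i)) (T (v j)) = if i = j then l j else 0 := by
    intro i j
    have h1 : (LinearMap.adjoint T) (T (v j)) = l j • v j := by
      exact hS.apply_eigenvectorBasis hn j
    rw [← LinearMap.adjoint_inner_right, h1, inner_smul_right,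
      orthonormal_iff_ite.1 v.orthonormal]
    split_ifs <;> simp
  let w : Fin n → EuclideanSpace ℝ (Fin n) := fun i ↦ (√(l i))⁻¹ • T (v i)
  have hw : Orthonormal ℝ (({i | l i ≠ 0} : Set (Fin n)).domRestrict w) := by
    rw [orthonormal_iff_ite]
    rintro ⟨i, hi⟩ ⟨j, hj⟩
    have hj' : 0 < l j := lt_of_le_of_ne (hl0 j) (Ne.symm hj)
    simp only [Set.domRestrict_apply, w, inner_smul_left, inner_smul_right, hin, Subtype.mk.injEq]
    split_ifs with h
    · subst h
      have := Real.mul_self_sqrt hj'.le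
      have h2 : √(l i) ≠ 0 := (Real.sqrt_pos.2 hj').ne'
      simp only [conj_trivial]
      field_simp
      nlinarith
    · simp
  obtain ⟨u, hu⟩ := hw.exists_orthonormalBasis_extension_of_card_eq (by simp)
  have hTv : ∀ i, T (v i) = √(l i) • u i := by
    intro i
    by_cases h : l i = 0
    · have : inner ℝ (T (v i)) (T (v i)) = 0 := by rw [hin, if_pos rfl, h]
      rw [inner_self_eq_zero.1 this, h]
      simp
    · have h2 : √(l i) ≠ 0 := (Real.sqrt_pos.2 (lt_of_le_of_ne (hl0 i) (Ne.symm h))).ne'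
      rw [hu i h]
      simp [w, smul_smul, h2]
  refine ⟨⟨u, v, fun i ↦ √(l i), fun i ↦ Real.sqrt_nonneg _,
    fun i j hij ↦ Real.sqrt_le_sqrt (hS.eigenvalues_antitone hn hij), ?_⟩⟩
  apply Matrix.toEuclideanLin.injective
  refine v.toBasis.ext fun k ↦ ?_
  change T _ = _
  rw [OrthonormalBasis.coe_toBasis, hTv]
  have hdot : ∀ i, (v i).ofLp ⬝ᵥ (v k).ofLp = if i = k then 1 else 0 := by
    intro i
    rw [← orthonormal_iff_ite.1 v.orthonormal i k]
    simp [PiLp.inner_apply, dotProduct, mul_comm]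
  ext a
  simp [Matrix.toLpLin_apply, Matrix.vecMulVec_mulVec, hdot, Finset.sum_apply, ite_apply]

/-- `‖Z‖_∞ = max_{i,j} |Z i j|`. -/
def maxNorm (Z : Matrix (Fin n) (Fin n) ℝ) : ℝ := ⨆ i, ⨆ j, |Z i j|

/-- `‖Z‖_{∞,2}`: the largest Euclidean norm of a row or a column. -/
def maxRowColNorm (Z : Matrix (Fin n) (Fin n) ℝ) : ℝ :=
  max (⨆ i, √(∑ b, Z i b ^ 2)) (⨆ j, √(∑ a, Z a j ^ 2))

/-- The Frobenius norm. -/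
def frobNorm (Z : Matrix (Fin n) (Fin n) ℝ) : ℝ := √(∑ i, ∑ j, Z i j ^ 2)

end SVDProjection

end

/-!
With high probability every row and column of `Ω` has at most `2pn` elements (Chernoff), so trimming
changes nothing and `(1/p) 𝒫_Ω M - M = Y / p`, where `Y` has the independent centred entries
`(1_{(i, j) ∈ Ω} - p) M i j`. By Weyl's inequality the truncated singular value decomposition is
within `2 ‖Y‖ / p` of `M` in operator norm, and the difference has rank at most `2r`, so passing to
the Frobenius norm costs a factor `√(2r)`.

The operator norm of `Y` is controlled through the trace moments of its Hermitian dilation. Writing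
that dilation as a series `X = ∑ e, (1_{e ∈ Ω} - p) H e` with variance proxy
`V = ∑ e, (1_{e ∈ Ω} + p) (H e)²`, an integration by parts in each indicator together with the
mean value inequality for traces gives `E tr X^{2k} ≤ (2k-1)/2 · E tr (V X^{2k-2})`, and Young's
inequality for traces absorbs `X` on the right, leaving `E tr X^{2k} ≤ k^k E tr V^k`. The matrix `V`
is diagonal, with sums of independent variables on the diagonal, so its moments are bounded by
scalar exponential moments. Finally, Markov's inequality is applied with `k` of order `log n`.
-/

noncomputable section

open Matrix
open scoped Matrix.Norms.L2Operator
open Finset.HasAntidiagonal (antidiagonal)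

namespace SVDProjection

section TraceInequalities

theorem pow_mul_pow_add_pow_mul_pow_le {a b : ℝ} (ha : 0 ≤ a) (hb : 0 ≤ b) (s t : ℕ) :
    a ^ s * b ^ t + a ^ t * b ^ s ≤ a ^ (s + t) + b ^ (s + t) := by
  have h : 0 ≤ (a ^ s - b ^ s) * (a ^ t - b ^ t) := by
    rcases le_total a b with hab | hab
    · exact mul_nonneg_of_nonpos_of_nonpos (sub_nonpos.2 (pow_le_pow_left₀ ha hab s))
        (sub_nonpos.2 (pow_le_pow_left₀ ha hab t))
    · exact mul_nonneg (sub_nonneg.2 (pow_le_pow_left₀ hb hab s))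
        (sub_nonneg.2 (pow_le_pow_left₀ hb hab t))
  rw [pow_add, pow_add]
  linarith

theorem sum_antidiagonal_pow_mul_pow_le (a b : ℝ) (N : ℕ) :
    ∑ q ∈ antidiagonal (2 * N), a ^ q.1 * b ^ q.2 ≤
      (2 * N + 1) / 2 * (a ^ (2 * N) + b ^ (2 * N)) := by
  have even_abs (x : ℝ) : |x| ^ (2 * N) = x ^ (2 * N) := (even_two_mul N).pow_abs x
  have symmetrize : ∑ q ∈ antidiagonal (2 * N), |a| ^ q.1 * |b| ^ q.2 =
      ∑ q ∈ antidiagonal (2 * N), |a| ^ q.2 * |b| ^ q.1 :=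
    Finset.Nat.sum_antidiagonal_swap (f := fun q ↦ |a| ^ q.2 * |b| ^ q.1)
  have pairing : ∑ q ∈ antidiagonal (2 * N),
      (|a| ^ q.1 * |b| ^ q.2 + |a| ^ q.2 * |b| ^ q.1) ≤
      (2 * N + 1) * (a ^ (2 * N) + b ^ (2 * N)) := by
    refine (Finset.sum_le_card_nsmul _ _ (a ^ (2 * N) + b ^ (2 * N)) fun q hq ↦ ?_).trans_eq ?_
    · rw [← even_abs a, ← even_abs b, ← Finset.HasAntidiagonal.mem_antidiagonal.1 hq]
      exact pow_mul_pow_add_pow_mul_pow_le (abs_nonneg a) (abs_nonneg b) q.1 q.2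
    · rw [Finset.Nat.card_antidiagonal, nsmul_eq_mul]
      push_cast
      rfl
  rw [Finset.sum_add_distrib, ← symmetrize] at pairing
  have : ∑ q ∈ antidiagonal (2 * N), a ^ q.1 * b ^ q.2 ≤
      ∑ q ∈ antidiagonal (2 * N), |a| ^ q.1 * |b| ^ q.2 :=
    Finset.sum_le_sum fun q _ ↦ (le_abs_self _).trans_eq (by rw [abs_mul, abs_pow, abs_pow])
  linarith

theorem succ_mul_mul_pow_le_pow_succ_add {a b : ℝ} (ha : 0 ≤ a) (hb : 0 ≤ b) (N : ℕ) :
    (N + 1) * (a * b ^ N) ≤ a ^ (N + 1) + N * b ^ (N + 1) := by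
  induction N with
  | zero => simp
  | succ N ih =>
    have rearrangement := pow_mul_pow_add_pow_mul_pow_le ha hb 1 (N + 1)
    have := mul_le_mul_of_nonneg_right ih hb
    push_cast
    ring_nf at this rearrangement ⊢
    linarith

theorem pow_succ_sub_pow_succ_eq_sum_antidiagonal {R : Type*} [Ring R] (a b : R) (N : ℕ) :
    a ^ (N + 1) - b ^ (N + 1) =
      ∑ q ∈ antidiagonal N, a ^ q.1 * (a - b) * b ^ q.2 := by
  induction N with
  | zero => simp
  | succ N ih =>
    calc a ^ (N + 2) - b ^ (N + 2)
        = a ^ (N + 1) * (a - b) + (a ^ (N + 1) - b ^ (N + 1)) * b := by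
          rw [mul_sub, sub_mul, ← pow_succ, ← pow_succ, sub_add_sub_cancel]
      _ = a ^ (N + 1) * (a - b) +
          ∑ q ∈ antidiagonal N, a ^ q.1 * (a - b) * b ^ (q.2 + 1) := by
          rw [ih, Finset.sum_mul]
          simp only [pow_succ, mul_assoc]
      _ = ∑ q ∈ antidiagonal (N + 1), a ^ q.1 * (a - b) * b ^ q.2 := by
          rw [Finset.Nat.sum_antidiagonal_succ', pow_zero, mul_one]

variable {m n : Type*} [Fintype m] [DecidableEq m] [Fintype n] [DecidableEq n]
  {A : Matrix m m ℝ} {B : Matrix n n ℝ}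

theorem isHermitian_pow_eq (hA : A.IsHermitian) (k : ℕ) :
    A ^ k = (hA.eigenvectorUnitary : Matrix m m ℝ) * diagonal (fun i ↦ hA.eigenvalues i ^ k) *
      (hA.eigenvectorUnitary : Matrix m m ℝ)ᴴ := by
  conv_lhs => rw [hA.spectral_theorem, ← map_pow, diagonal_pow]
  rw [Unitary.conjStarAlgAut_apply, star_eq_conjTranspose]
  rfl

/-- The matrix of the bilinear form `H` with respect to the eigenbases of `A` and `B`. -/
def eigenbasisMatrix (hA : A.IsHermitian) (hB : B.IsHermitian) (H : Matrix m n ℝ) :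
    Matrix m n ℝ :=
  (hA.eigenvectorUnitary : Matrix m m ℝ)ᴴ * H * (hB.eigenvectorUnitary : Matrix n n ℝ)

theorem trace_conjTranspose_mul_pow_mul_mul_pow (hA : A.IsHermitian) (hB : B.IsHermitian)
    (H : Matrix m n ℝ) (s t : ℕ) :
    (Hᴴ * A ^ s * H * B ^ t).trace = ∑ i, ∑ j, eigenbasisMatrix hA hB H i j ^ 2 *
      (hA.eigenvalues i ^ s * hB.eigenvalues j ^ t) := by
  have conj : (Hᴴ * A ^ s * H * B ^ t).trace =
      ((eigenbasisMatrix hA hB H)ᴴ * diagonal (fun i ↦ hA.eigenvalues i ^ s) *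
        eigenbasisMatrix hA hB H * diagonal (fun j ↦ hB.eigenvalues j ^ t)).trace := by
    rw [isHermitian_pow_eq hA, isHermitian_pow_eq hB, ← Matrix.mul_assoc, trace_mul_comm]
    simp only [eigenbasisMatrix, conjTranspose_mul, conjTranspose_conjTranspose,
      Matrix.mul_assoc]
  rw [conj, trace, Finset.sum_comm]
  refine Finset.sum_congr rfl fun j _ ↦ ?_
  rw [diag_apply, mul_diagonal, Matrix.mul_apply, Finset.sum_mul]
  refine Finset.sum_congr rfl fun i _ ↦ ?_
  rw [mul_diagonal, conjTranspose_apply, star_trivial]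
  ring

theorem sum_antidiagonal_trace_le (hA : A.IsHermitian) (hB : B.IsHermitian)
    (H : Matrix m n ℝ) (N : ℕ) :
    ∑ q ∈ antidiagonal (2 * N), (Hᴴ * A ^ q.1 * H * B ^ q.2).trace ≤
      (2 * N + 1) / 2 * ((H * Hᴴ * A ^ (2 * N)).trace + (Hᴴ * H * B ^ (2 * N)).trace) := by
  have left : (H * Hᴴ * A ^ (2 * N)).trace = (Hᴴ * A ^ (2 * N) * H * B ^ 0).trace := by
    rw [pow_zero, Matrix.mul_one, Matrix.mul_assoc, trace_mul_comm]
  have right : (Hᴴ * H * B ^ (2 * N)).trace = (Hᴴ * A ^ 0 * H * B ^ (2 * N)).trace := by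
    rw [pow_zero, Matrix.mul_one]
  simp only [left, right, trace_conjTranspose_mul_pow_mul_mul_pow hA hB]
  simp only [pow_zero, mul_one, one_mul]
  rw [Finset.sum_comm, ← Finset.sum_add_distrib, Finset.mul_sum]
  refine Finset.sum_le_sum fun i _ ↦ ?_
  rw [Finset.sum_comm, ← Finset.sum_add_distrib, Finset.mul_sum]
  refine Finset.sum_le_sum fun j _ ↦ ?_
  rw [← Finset.mul_sum, ← mul_add, mul_left_comm]
  exact mul_le_mul_of_nonneg_left (sum_antidiagonal_pow_mul_pow_le _ _ N) (sq_nonneg _)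

theorem succ_mul_trace_mul_pow_le {V W : Matrix m m ℝ} (hV : V.PosSemidef) (hW : W.PosSemidef)
    (N : ℕ) :
    (N + 1) * (V * W ^ N).trace ≤ (V ^ (N + 1)).trace + N * (W ^ (N + 1)).trace := by
  have expand (s t : ℕ) : (V ^ s * W ^ t).trace =
      ∑ i, ∑ j, eigenbasisMatrix hV.1 hW.1 1 i j ^ 2 *
        (hV.1.eigenvalues i ^ s * hW.1.eigenvalues j ^ t) := by
    rw [← trace_conjTranspose_mul_pow_mul_mul_pow hV.1 hW.1, conjTranspose_one, Matrix.one_mul,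
      Matrix.mul_one]
  have mixed := expand 1 N
  have left := expand (N + 1) 0
  have right := expand 0 (N + 1)
  simp only [pow_zero, pow_one, mul_one, one_mul]
    at mixed left right
  rw [mixed, left, right]
  simp only [Finset.mul_sum, ← Finset.sum_add_distrib]
  refine Finset.sum_le_sum fun i _ ↦ Finset.sum_le_sum fun j _ ↦ ?_
  rw [mul_left_comm, mul_left_comm (N : ℝ), ← mul_add]
  exact mul_le_mul_of_nonneg_left (succ_mul_mul_pow_le_pow_succ_add
    (hV.eigenvalues_nonneg i) (hW.eigenvalues_nonneg j) N) (sq_nonneg _)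

theorem trace_pow_eq_sum_eigenvalues_pow (hA : A.IsHermitian) (k : ℕ) :
    (A ^ k).trace = ∑ i, hA.eigenvalues i ^ k := by
  rw [isHermitian_pow_eq hA, trace_mul_cycle, ← star_eq_conjTranspose,
    Unitary.coe_star_mul_self, Matrix.one_mul, trace_diagonal]

theorem posSemidef_pow_two_mul (hA : A.IsHermitian) (k : ℕ) : (A ^ (2 * k)).PosSemidef := by
  have := posSemidef_conjTranspose_mul_self (A ^ k)
  rwa [(hA.pow k).eq, ← pow_add, ← two_mul] at this

theorem trace_mul_self_mul_pow_nonneg (hA : A.IsHermitian) {H : Matrix m m ℝ}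
    (hH : H.IsHermitian) (k : ℕ) : 0 ≤ (H ^ 2 * A ^ (2 * k)).trace := by
  have := ((posSemidef_pow_two_mul hA k).conjTranspose_mul_mul_same H).trace_nonneg
  rwa [hH.eq, trace_mul_comm, ← Matrix.mul_assoc, ← sq] at this

theorem norm_eq_norm_eigenvalues (hA : A.IsHermitian) : ‖A‖ = ‖hA.eigenvalues‖ := by
  conv_lhs => rw [hA.spectral_theorem, Unitary.conjStarAlgAut_apply]
  rw [← Unitary.coe_star, CStarRing.norm_mul_coe_unitary, CStarRing.norm_coe_unitary_mul,
    l2_opNorm_diagonal]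
  rfl

theorem norm_le_of_trace_pow_two_mul_le (hA : A.IsHermitian) {k : ℕ} (hk : k ≠ 0) {t : ℝ}
    (ht : 0 ≤ t) (h : (A ^ (2 * k)).trace ≤ t ^ (2 * k)) : ‖A‖ ≤ t := by
  have even : Even (2 * k) := even_two_mul k
  rw [trace_pow_eq_sum_eigenvalues_pow hA] at h
  rw [norm_eq_norm_eigenvalues hA, pi_norm_le_iff_of_nonneg ht]
  refine fun i ↦ le_of_pow_le_pow_left₀ (n := 2 * k) (by positivity) ht ?_
  calc ‖hA.eigenvalues i‖ ^ (2 * k) = hA.eigenvalues i ^ (2 * k) := even.pow_abs _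
    _ ≤ ∑ j, hA.eigenvalues j ^ (2 * k) :=
        Finset.single_le_sum (fun j _ ↦ even.pow_nonneg (hA.eigenvalues j)) (Finset.mem_univ i)
    _ ≤ t ^ (2 * k) := h

end TraceInequalities

section IndepRandomSet

variable {S ι : Type*} [MeasurableSpace S]

/-- `Ω` is a random subset of `ι` containing each `e` with probability `π e`, independently of
the other elements: the sampling model of `IsBernoulliSample` on an arbitrary index type and with
element-dependent probabilities. -/
structure IsIndepRandomSet (P : Measure S) (π : ι → ℝ) (Ω : S → Set ι) : Prop where
  measurableSet_mem : ∀ e, MeasurableSet {ω | e ∈ Ω ω}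
  indep : iIndepSet (fun e ↦ {ω | e ∈ Ω ω}) P
  prob : ∀ e, P.real {ω | e ∈ Ω ω} = π e

namespace IsIndepRandomSet

variable {P : Measure S} {π : ι → ℝ} {Ω : S → Set ι}

theorem prob_nonneg (h : IsIndepRandomSet P π Ω) (e : ι) : 0 ≤ π e :=
  h.prob e ▸ measureReal_nonneg

theorem preimage (h : IsIndepRandomSet P π Ω) {κ : Type*} {f : κ → ι}
    (hf : Function.Injective f) : IsIndepRandomSet P (π ∘ f) fun ω ↦ f ⁻¹' Ω ω where
  measurableSet_mem e := h.measurableSet_mem (f e)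
  indep := h.indep.precomp hf
  prob e := h.prob (f e)

theorem measurable (h : IsIndepRandomSet P π Ω) : Measurable Ω :=
  measurable_set_iff.2 fun e ↦ measurableSet_setOfPred.1 (h.measurableSet_mem e)

theorem integral_indicator_one (h : IsIndepRandomSet P π Ω) (e : ι) :
    ∫ ω, (Ω ω).indicator (1 : ι → ℝ) e ∂P = π e :=
  (MeasureTheory.integral_indicator_one (h.measurableSet_mem e)).trans (h.prob e)

theorem indepFun_mem_sdiff_singleton (h : IsIndepRandomSet P π Ω) (e : ι) :
    IndepFun (fun ω ↦ e ∈ Ω ω) (fun ω ↦ Ω ω \ {e}) P := by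
  rw [IndepFun_iff_Indep]
  refine indep_of_indep_of_le_left (indep_of_indep_of_le_right
    (h.indep.indep_generateFrom_of_disjoint h.measurableSet_mem {e} {e}ᶜ disjoint_compl_right)
    ?_) ?_
  · refine Measurable.comap_le ((@measurable_set_iff ι S (.generateFrom _) _).2 fun a ↦
      (@measurableSet_setOfPred S (.generateFrom _) _).1 ?_)
    by_cases ha : a = e
    · simp [ha]
    · simpa [ha] using MeasurableSpace.measurableSet_generateFrom
        (s := {t | ∃ k ∈ ({e}ᶜ : Set ι), {ω | k ∈ Ω ω} = t}) ⟨a, ha, rfl⟩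
  · exact Measurable.comap_le <| (@measurableSet_setOfPred S (.generateFrom _) _).1 <|
      MeasurableSpace.measurableSet_generateFrom ⟨e, rfl, rfl⟩

variable [IsProbabilityMeasure P]

theorem prob_le_one (h : IsIndepRandomSet P π Ω) (e : ι) : π e ≤ 1 :=
  h.prob e ▸ measureReal_le_one

theorem integrable_comp [Finite ι] (h : IsIndepRandomSet P π Ω) (F : Set ι → ℝ) :
    Integrable (fun ω ↦ F (Ω ω)) P :=
  have := Measure.isProbabilityMeasure_map (μ := P) h.measurable.aemeasurable
  (Integrable.of_finite (μ := P.map Ω)).comp_measurable h.measurable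

variable [Finite ι]

theorem integral_mul_comp_sdiff_singleton (h : IsIndepRandomSet P π Ω) (e : ι) (c : ℝ → ℝ)
    (F : Set ι → ℝ) :
    ∫ ω, c ((Ω ω).indicator 1 e) * F (Ω ω \ {e}) ∂P =
      (∫ ω, c ((Ω ω).indicator 1 e) ∂P) * ∫ ω, F (Ω ω \ {e}) ∂P := by
  classical
  have indep := (h.indepFun_mem_sdiff_singleton e).comp
    (φ := fun q ↦ c (if q then 1 else 0)) (ψ := F) .of_discrete .of_discrete
  simpa only [Set.indicator_apply, Pi.one_apply, Function.comp_apply] using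
    indep.integral_fun_mul_eq_mul_integral
      (h.integrable_comp fun s ↦ c (if e ∈ s then 1 else 0)).aestronglyMeasurable
      (h.integrable_comp fun s ↦ F (s \ {e})).aestronglyMeasurable

theorem integral_comp_eq_resample (h : IsIndepRandomSet P π Ω) (e : ι) (F : Set ι → ℝ) :
    ∫ ω, F (Ω ω) ∂P =
      π e * ∫ ω, F (insert e (Ω ω)) ∂P + (1 - π e) * ∫ ω, F (Ω ω \ {e}) ∂P := by
  have split (ω : S) : F (Ω ω) =
      (Ω ω).indicator (1 : ι → ℝ) e * F (insert e (Ω ω \ {e})) +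
        (1 - (Ω ω).indicator (1 : ι → ℝ) e) * F (Ω ω \ {e}) := by
    by_cases he : e ∈ Ω ω <;> simp [he]
  have integral_compl : ∫ ω, (1 - (Ω ω).indicator (1 : ι → ℝ) e) ∂P = 1 - π e := by
    rw [integral_sub (integrable_const 1) (h.integrable_comp fun s ↦ s.indicator 1 e),
      h.integral_indicator_one, integral_const, probReal_univ, one_smul]
  simp only [split]
  rw [integral_add
      (h.integrable_comp fun s ↦ s.indicator (1 : ι → ℝ) e * F (insert e (s \ {e})))
      (h.integrable_comp fun s ↦ (1 - s.indicator (1 : ι → ℝ) e) * F (s \ {e})),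
    h.integral_mul_comp_sdiff_singleton e (fun x ↦ x) fun s ↦ F (insert e s),
    h.integral_mul_comp_sdiff_singleton e (fun x ↦ 1 - x), h.integral_indicator_one,
    integral_compl]
  simp only [Set.insert_sdiff_singleton]

theorem integral_indicator_sub_mul (h : IsIndepRandomSet P π Ω) (e : ι) (F : Set ι → ℝ) :
    ∫ ω, ((Ω ω).indicator 1 e - π e) * F (Ω ω) ∂P =
      π e * (1 - π e) * ∫ ω, (F (insert e (Ω ω)) - F (Ω ω \ {e})) ∂P := by
  have present (s : Set ι) : (insert e s).indicator (1 : ι → ℝ) e = 1 := by simp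
  have absent (s : Set ι) : (s \ {e}).indicator (1 : ι → ℝ) e = 0 := by simp
  rw [h.integral_comp_eq_resample e fun s ↦ (s.indicator 1 e - π e) * F s,
    integral_sub (h.integrable_comp fun s ↦ F (insert e s))
      (h.integrable_comp fun s ↦ F (s \ {e}))]
  simp only [present, absent, integral_const_mul]
  ring

theorem mul_integral_add_le (h : IsIndepRandomSet P π Ω) (e : ι) {G : Set ι → ℝ}
    (hG : ∀ s, 0 ≤ G s) :
    π e * (1 - π e) * ∫ ω, (G (insert e (Ω ω)) + G (Ω ω \ {e})) ∂P ≤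
      ∫ ω, ((Ω ω).indicator 1 e + π e) * G (Ω ω) ∂P := by
  have present (s : Set ι) : (insert e s).indicator (1 : ι → ℝ) e = 1 := by simp
  have absent (s : Set ι) : (s \ {e}).indicator (1 : ι → ℝ) e = 0 := by simp
  have nonneg : 0 ≤ ∫ ω, G (insert e (Ω ω)) ∂P := integral_nonneg fun ω ↦ hG _
  rw [h.integral_comp_eq_resample e fun s ↦ (s.indicator 1 e + π e) * G s,
    integral_add (h.integrable_comp fun s ↦ G (insert e s))
      (h.integrable_comp fun s ↦ G (s \ {e}))]
  simp only [present, absent, integral_const_mul]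
  nlinarith [mul_nonneg (mul_self_nonneg (π e)) nonneg]

end IsIndepRandomSet

end IndepRandomSet

section MatrixMoments

variable {ι E m : Type*} [Fintype ι] [AddCommGroup E] [Module ℝ E]

/-- The centred random series `∑ e, (1_{e ∈ s} - π e) • H e`, as a function of the realization `s`
of the random set. -/
def centeredSeries (π : ι → ℝ) (H : ι → E) (s : Set ι) : E :=
  ∑ e, (s.indicator 1 e - π e) • H e

theorem centeredSeries_insert_sub_sdiff (π : ι → ℝ) (H : ι → E) (s : Set ι) (e : ι) :
    centeredSeries π H (insert e s) - centeredSeries π H (s \ {e}) = H e := by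
  classical
  simp only [centeredSeries, ← Finset.sum_sub_distrib, ← sub_smul, sub_sub_sub_cancel_right]
  rw [Finset.sum_eq_single e (fun a _ ha ↦ by simp [Set.indicator_apply, ha]) (by simp)]
  simp

theorem map_centeredSeries {F : Type*} [AddCommGroup F] [Module ℝ F] (f : E →ₗ[ℝ] F)
    (π : ι → ℝ) (H : ι → E) (s : Set ι) :
    f (centeredSeries π H s) = centeredSeries π (fun e ↦ f (H e)) s := by
  simp [centeredSeries]

theorem isHermitian_centeredSeries {H : ι → Matrix m m ℝ} (hH : ∀ e, (H e).IsHermitian)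
    (π : ι → ℝ) (s : Set ι) : (centeredSeries π H s).IsHermitian :=
  isSelfAdjoint_sum _ fun e _ ↦ (IsSelfAdjoint.all (s.indicator 1 e - π e)).smul (hH e)

variable [Fintype m]

theorem trace_centeredSeries_mul (π : ι → ℝ) (H : ι → Matrix m m ℝ) (s : Set ι)
    (Z : Matrix m m ℝ) : (centeredSeries π H s * Z).trace =
      ∑ e, (s.indicator 1 e - π e) * (H e * Z).trace := by
  simp [centeredSeries, Finset.sum_mul, trace_sum]

variable [DecidableEq m]

/-- The matrix `∑ e, (1_{e ∈ s} + π e) • H e ^ 2` dominating the conditional variance of the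
centred series in the exchangeable pairs argument. -/
def varianceProxy (π : ι → ℝ) (H : ι → Matrix m m ℝ) (s : Set ι) : Matrix m m ℝ :=
  ∑ e, (s.indicator 1 e + π e) • H e ^ 2

theorem trace_varianceProxy_mul (π : ι → ℝ) (H : ι → Matrix m m ℝ) (s : Set ι)
    (Z : Matrix m m ℝ) : (varianceProxy π H s * Z).trace =
      ∑ e, (s.indicator 1 e + π e) * (H e ^ 2 * Z).trace := by
  simp [varianceProxy, Finset.sum_mul, trace_sum]

theorem posSemidef_varianceProxy {π : ι → ℝ} (hπ : ∀ e, 0 ≤ π e) {H : ι → Matrix m m ℝ}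
    (hH : ∀ e, (H e).IsHermitian) (s : Set ι) : (varianceProxy π H s).PosSemidef := by
  refine posSemidef_sum _ fun e _ ↦ ?_
  have square := posSemidef_conjTranspose_mul_self (H e)
  rw [(hH e).eq, ← sq] at square
  exact square.smul (add_nonneg (Set.indicator_nonneg (fun _ _ ↦ zero_le_one) e) (hπ e))

theorem trace_sub_mul_pow_sub_pow_le {A B : Matrix m m ℝ} (hA : A.IsHermitian)
    (hB : B.IsHermitian) (N : ℕ) :
    ((A - B) * A ^ (2 * N + 1)).trace - ((A - B) * B ^ (2 * N + 1)).trace ≤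
      (2 * N + 1) / 2 *
        (((A - B) ^ 2 * A ^ (2 * N)).trace + ((A - B) ^ 2 * B ^ (2 * N)).trace) := by
  have mean_value := sum_antidiagonal_trace_le hA hB (A - B) N
  rw [(hA.sub hB).eq, ← sq] at mean_value
  rw [← trace_sub, ← Matrix.mul_sub, pow_succ_sub_pow_succ_eq_sum_antidiagonal, Finset.mul_sum,
    trace_sum]
  simpa only [Matrix.mul_assoc] using mean_value

namespace IsIndepRandomSet

variable {S : Type*} [MeasurableSpace S] {P : Measure S} [IsProbabilityMeasure P] {π : ι → ℝ}
  {Ω : S → Set ι} {H : ι → Matrix m m ℝ}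

theorem integral_indicator_sub_mul_trace_le (h : IsIndepRandomSet P π Ω)
    (hH : ∀ e, (H e).IsHermitian) (N : ℕ) (e : ι) :
    ∫ ω, ((Ω ω).indicator 1 e - π e) *
        (H e * centeredSeries π H (Ω ω) ^ (2 * N + 1)).trace ∂P ≤
      (2 * N + 1) / 2 * ∫ ω, ((Ω ω).indicator 1 e + π e) *
        (H e ^ 2 * centeredSeries π H (Ω ω) ^ (2 * N)).trace ∂P := by
  have herm := isHermitian_centeredSeries hH π
  let F (s : Set ι) : ℝ := (H e * centeredSeries π H s ^ (2 * N + 1)).trace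
  let G (s : Set ι) : ℝ := (H e ^ 2 * centeredSeries π H s ^ (2 * N)).trace
  have increment (s : Set ι) :
      F (insert e s) - F (s \ {e}) ≤ (2 * N + 1) / 2 * (G (insert e s) + G (s \ {e})) := by
    have mean_value := trace_sub_mul_pow_sub_pow_le (herm (insert e s)) (herm (s \ {e})) N
    rwa [centeredSeries_insert_sub_sdiff] at mean_value
  calc ∫ ω, ((Ω ω).indicator 1 e - π e) * F (Ω ω) ∂P
      = π e * (1 - π e) * ∫ ω, (F (insert e (Ω ω)) - F (Ω ω \ {e})) ∂P :=
        h.integral_indicator_sub_mul e F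
    _ ≤ π e * (1 - π e) *
          ∫ ω, (2 * N + 1) / 2 * (G (insert e (Ω ω)) + G (Ω ω \ {e})) ∂P :=
        mul_le_mul_of_nonneg_left (integral_mono
          (h.integrable_comp fun s ↦ F (insert e s) - F (s \ {e}))
          (h.integrable_comp fun s ↦ (2 * N + 1) / 2 * (G (insert e s) + G (s \ {e})))
          fun ω ↦ increment (Ω ω))
          (mul_nonneg (h.prob_nonneg e) (sub_nonneg.2 (h.prob_le_one e)))
    _ = (2 * N + 1) / 2 *
          (π e * (1 - π e) * ∫ ω, (G (insert e (Ω ω)) + G (Ω ω \ {e})) ∂P) := by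
        rw [integral_const_mul, mul_left_comm]
    _ ≤ (2 * N + 1) / 2 * ∫ ω, ((Ω ω).indicator 1 e + π e) * G (Ω ω) ∂P :=
        mul_le_mul_of_nonneg_left (h.mul_integral_add_le e fun s ↦
          trace_mul_self_mul_pow_nonneg (herm s) (hH e) N) (by positivity)

theorem integral_trace_centeredSeries_pow_le_variance (h : IsIndepRandomSet P π Ω)
    (hH : ∀ e, (H e).IsHermitian) (N : ℕ) :
    ∫ ω, (centeredSeries π H (Ω ω) ^ (2 * (N + 1))).trace ∂P ≤ (2 * N + 1) / 2 *
      ∫ ω, (varianceProxy π H (Ω ω) * centeredSeries π H (Ω ω) ^ (2 * N)).trace ∂P := by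
  simp only [show 2 * (N + 1) = 2 * N + 1 + 1 by ring, pow_succ' _ (2 * N + 1),
    trace_varianceProxy_mul]
  simp only [trace_centeredSeries_mul π H _ (centeredSeries π H _ ^ (2 * N + 1))]
  rw [integral_finsetSum _ fun e _ ↦ h.integrable_comp fun s ↦
      (s.indicator 1 e - π e) * (H e * centeredSeries π H s ^ (2 * N + 1)).trace,
    integral_finsetSum _ fun e _ ↦ h.integrable_comp fun s ↦
      (s.indicator 1 e + π e) * (H e ^ 2 * centeredSeries π H s ^ (2 * N)).trace,
    Finset.mul_sum]
  exact Finset.sum_le_sum fun e _ ↦ h.integral_indicator_sub_mul_trace_le hH N e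

theorem sq_mul_integral_trace_variance_le (h : IsIndepRandomSet P π Ω)
    (hH : ∀ e, (H e).IsHermitian) (N : ℕ) :
    (N + 1) ^ 2 *
        ∫ ω, (varianceProxy π H (Ω ω) * centeredSeries π H (Ω ω) ^ (2 * N)).trace ∂P ≤
      (N + 1) ^ (N + 1) * ∫ ω, (varianceProxy π H (Ω ω) ^ (N + 1)).trace ∂P +
        N * ∫ ω, (centeredSeries π H (Ω ω) ^ (2 * (N + 1))).trace ∂P := by
  set Y : Set ι → Matrix m m ℝ := centeredSeries π H
  set V : Set ι → Matrix m m ℝ := varianceProxy π H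
  simp only [← integral_const_mul]
  rw [← integral_add
    (h.integrable_comp fun s ↦ (N + 1) ^ (N + 1) * (V s ^ (N + 1)).trace)
    (h.integrable_comp fun s ↦ N * (Y s ^ (2 * (N + 1))).trace)]
  refine integral_mono (h.integrable_comp fun s ↦ (N + 1) ^ 2 * (V s * Y s ^ (2 * N)).trace)
    (h.integrable_comp fun s ↦ (N + 1) ^ (N + 1) * (V s ^ (N + 1)).trace +
      N * (Y s ^ (2 * (N + 1))).trace) fun ω ↦ ?_
  have young := succ_mul_trace_mul_pow_le
    ((posSemidef_varianceProxy h.prob_nonneg hH (Ω ω)).smul (by positivity : (0 : ℝ) ≤ N + 1))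
    (posSemidef_pow_two_mul (isHermitian_centeredSeries hH π (Ω ω)) 1) N
  simpa only [smul_pow, smul_mul_assoc, trace_smul, smul_eq_mul, ← pow_mul, mul_one,
    ← mul_assoc, ← sq] using young

/-- The matrix Efron–Stein moment inequality of Paulin, Mackey and Tropp. -/
theorem integral_trace_centeredSeries_pow_le (h : IsIndepRandomSet P π Ω)
    (hH : ∀ e, (H e).IsHermitian) {k : ℕ} (hk : k ≠ 0) :
    ∫ ω, (centeredSeries π H (Ω ω) ^ (2 * k)).trace ∂P ≤
      k ^ k * ∫ ω, (varianceProxy π H (Ω ω) ^ k).trace ∂P := by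
  obtain ⟨N, rfl⟩ := Nat.exists_eq_add_one_of_ne_zero hk
  have by_parts := h.integral_trace_centeredSeries_pow_le_variance hH N
  have young := h.sq_mul_integral_trace_variance_le hH N
  have nonneg : 0 ≤ ∫ ω, (varianceProxy π H (Ω ω) ^ (N + 1)).trace ∂P :=
    integral_nonneg fun ω ↦ ((posSemidef_varianceProxy h.prob_nonneg hH (Ω ω)).pow _).trace_nonneg
  have nonneg' := mul_nonneg (by positivity : (0 : ℝ) ≤ (N + 1) ^ (N + 1)) nonneg
  push_cast
  refine le_of_mul_le_mul_left ?_ (by positivity : (0 : ℝ) < 3 / 2 * N + 1)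
  linear_combination (N + 1) ^ 2 * by_parts + (2 * N + 1) / 2 * young + (N + 1) / 2 * nonneg'

end IsIndepRandomSet

end MatrixMoments

section ScalarConcentration

namespace IsIndepRandomSet

variable {ι S : Type*} [MeasurableSpace S] {P : Measure S} [IsProbabilityMeasure P] {π : ι → ℝ}
  {Ω : S → Set ι}

theorem mgf_sum_indicator_mul_le (h : IsIndepRandomSet P π Ω) (s : Finset ι) (a : ι → ℝ) (t : ℝ) :
    mgf (fun ω ↦ ∑ e ∈ s, (Ω ω).indicator 1 e * a e) P t ≤
      Real.exp (∑ e ∈ s, π e * (Real.exp (t * a e) - 1)) := by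
  let X (e : ι) (ω : S) : ℝ := {ω | e ∈ Ω ω}.indicator 1 ω * a e
  have measurable_indicator (e : ι) : Measurable ({ω | e ∈ Ω ω}.indicator (1 : S → ℝ)) :=
    measurable_one.indicator (h.measurableSet_mem e)
  have indep : iIndepFun X P :=
    h.indep.iIndepFun_indicator.comp (fun e x ↦ x * a e) fun e ↦ measurable_id.mul_const (a e)
  have mgf_X (e : ι) : mgf (X e) P t = π e * (Real.exp (t * a e) - 1) + 1 := by
    have affine (ω : S) : Real.exp (t * X e ω) =
        {ω | e ∈ Ω ω}.indicator (1 : S → ℝ) ω * (Real.exp (t * a e) - 1) + 1 := by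
      by_cases he : e ∈ Ω ω <;> simp [X, he]
    simp only [mgf, affine]
    rw [integral_add (((integrable_const 1).indicator (h.measurableSet_mem e)).mul_const _)
      (integrable_const 1), integral_mul_const, MeasureTheory.integral_indicator_one
      (h.measurableSet_mem e), h.prob, integral_const, probReal_univ, one_smul]
  have sum_eq : (fun ω ↦ ∑ e ∈ s, (Ω ω).indicator 1 e * a e) = ∑ e ∈ s, X e := by
    ext ω
    rw [Finset.sum_apply]
    rfl
  rw [sum_eq, indep.mgf_sum fun e ↦ (measurable_indicator e).mul_const (a e), Real.exp_sum]
  exact Finset.prod_le_prod (fun e _ ↦ mgf_nonneg) fun e _ ↦ mgf_X e ▸ Real.add_one_le_exp _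

variable [Finite ι]

theorem measureReal_two_mul_sum_lt_le (h : IsIndepRandomSet P π Ω) (s : Finset ι) :
    P.real {ω | 2 * ∑ e ∈ s, π e < ∑ e ∈ s, (Ω ω).indicator 1 e} ≤
      Real.exp (-(∑ e ∈ s, π e) / 4) := by
  set μ := ∑ e ∈ s, π e with hμ
  have μ_nonneg : 0 ≤ μ := Finset.sum_nonneg fun e _ ↦ h.prob_nonneg e
  have chernoff := measure_ge_le_exp_mul_mgf (μ := P) (2 * μ) (Real.log_nonneg one_le_two)
    (h.integrable_comp fun t ↦ Real.exp (Real.log 2 * ∑ e ∈ s, t.indicator 1 e))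
  have mgf_le := h.mgf_sum_indicator_mul_le s 1 (Real.log 2)
  simp only [Pi.one_apply, mul_one, Real.exp_log two_pos, ← Finset.sum_mul, ← hμ] at mgf_le
  calc P.real {ω | 2 * μ < ∑ e ∈ s, (Ω ω).indicator 1 e}
      ≤ P.real {ω | 2 * μ ≤ ∑ e ∈ s, (Ω ω).indicator 1 e} :=
        measureReal_mono fun ω (hω : 2 * μ < _) ↦ hω.le
    _ ≤ Real.exp (-Real.log 2 * (2 * μ)) * Real.exp (μ * (2 - 1)) :=
        chernoff.trans (mul_le_mul_of_nonneg_left mgf_le (Real.exp_nonneg _))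
    _ ≤ Real.exp (-μ / 4) := by
        rw [← Real.exp_add]
        gcongr
        nlinarith [Real.log_two_gt_d9]

end IsIndepRandomSet

theorem pow_le_pow_mul_exp_div {x τ : ℝ} (hx : 0 ≤ x) (hτ : 0 < τ) (k : ℕ) :
    x ^ k ≤ (k * τ) ^ k * Real.exp (x / τ) := by
  have series := Real.pow_div_factorial_le_exp (x / τ) (by positivity) k
  rw [div_le_iff₀ (by positivity), div_pow, div_le_iff₀ (by positivity)] at series
  calc x ^ k ≤ Real.exp (x / τ) * k.factorial * τ ^ k := series
    _ ≤ Real.exp (x / τ) * k ^ k * τ ^ k := by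
        gcongr
        exact_mod_cast Nat.factorial_le_pow k
    _ = (k * τ) ^ k * Real.exp (x / τ) := by rw [mul_pow]; ring

namespace IsIndepRandomSet

variable {ι S : Type*} [Fintype ι] [MeasurableSpace S] {P : Measure S} [IsProbabilityMeasure P]
  {π : ι → ℝ} {Ω : S → Set ι}

theorem integral_exp_sum_indicator_add_mul_le (h : IsIndepRandomSet P π Ω) {b : ι → ℝ}
    (hb₀ : ∀ e, 0 ≤ b e) (hb₁ : ∀ e, b e ≤ 1) :
    ∫ ω, Real.exp (∑ e, ((Ω ω).indicator 1 e + π e) * b e) ∂P ≤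
      Real.exp (3 * ∑ e, π e * b e) := by
  have exp_sub_one_le (e : ι) : Real.exp (1 * b e) - 1 ≤ 2 * b e := by
    have linear := Real.abs_exp_sub_one_le (x := b e) ((abs_of_nonneg (hb₀ e)).trans_le (hb₁ e))
    rw [abs_of_nonneg (hb₀ e)] at linear
    rw [one_mul]
    exact (le_abs_self _).trans linear
  have mgf_le := h.mgf_sum_indicator_mul_le Finset.univ b 1
  simp only [mgf, one_mul] at mgf_le exp_sub_one_le
  simp only [add_mul, Finset.sum_add_distrib, Real.exp_add, integral_mul_const]
  calc (∫ ω, Real.exp (∑ e, (Ω ω).indicator 1 e * b e) ∂P) * Real.exp (∑ e, π e * b e)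
      ≤ Real.exp (∑ e, π e * (Real.exp (b e) - 1)) * Real.exp (∑ e, π e * b e) := by gcongr
    _ ≤ Real.exp (2 * ∑ e, π e * b e) * Real.exp (∑ e, π e * b e) := by
        simp only [Finset.mul_sum, mul_left_comm (2 : ℝ)]
        gcongr with e
        · exact h.prob_nonneg e
        · exact exp_sub_one_le e
    _ = Real.exp (3 * ∑ e, π e * b e) := by rw [← Real.exp_add]; ring_nf

theorem integral_sum_indicator_add_mul_pow_le (h : IsIndepRandomSet P π Ω) {a : ι → ℝ} {τ : ℝ}
    (hτ : 0 < τ) (ha : ∀ e, 0 ≤ a e) (haτ : ∀ e, a e ≤ τ) {k : ℕ}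
    (hk : ∑ e, π e * a e ≤ k * τ) :
    ∫ ω, (∑ e, ((Ω ω).indicator 1 e + π e) * a e) ^ k ∂P ≤ (Real.exp 3 * (k * τ)) ^ k := by
  let Q (s : Set ι) : ℝ := ∑ e, (s.indicator 1 e + π e) * a e
  have Q_nonneg (s : Set ι) : 0 ≤ Q s := Finset.sum_nonneg fun e _ ↦ mul_nonneg
    (add_nonneg (Set.indicator_nonneg (fun _ _ ↦ zero_le_one) e) (h.prob_nonneg e)) (ha e)
  have exp_moment := h.integral_exp_sum_indicator_add_mul_le
    (fun e ↦ div_nonneg (ha e) hτ.le) fun e ↦ div_le_one_of_le₀ (haτ e) hτ.le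
  simp only [← mul_div_assoc, ← Finset.sum_div] at exp_moment
  calc ∫ ω, Q (Ω ω) ^ k ∂P
      ≤ ∫ ω, (k * τ) ^ k * Real.exp (Q (Ω ω) / τ) ∂P :=
        integral_mono (h.integrable_comp fun s ↦ Q s ^ k)
          (h.integrable_comp fun s ↦ (k * τ) ^ k * Real.exp (Q s / τ))
          fun ω ↦ pow_le_pow_mul_exp_div (Q_nonneg _) hτ k
    _ ≤ (k * τ) ^ k * Real.exp (k * 3) := by
        rw [integral_const_mul]
        refine mul_le_mul_of_nonneg_left (exp_moment.trans (Real.exp_le_exp.2 ?_)) (by positivity)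
        rw [mul_div_assoc, mul_comm]
        gcongr
        rwa [div_le_iff₀ hτ]
    _ = (Real.exp 3 * (k * τ)) ^ k := by rw [Real.exp_nat_mul, mul_pow _ (_ * τ), mul_comm]

end IsIndepRandomSet

end ScalarConcentration

section Dilation

variable {m n : Type*}

/-- The Hermitian dilation `[[0, B], [Bᵀ, 0]]`, which reduces rectangular matrices to Hermitian
ones. -/
def dilation : Matrix m n ℝ →ₗ[ℝ] Matrix (m ⊕ n) (m ⊕ n) ℝ where
  toFun B := fromBlocks 0 B Bᵀ 0
  map_add' A B := by simp [fromBlocks_add]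
  map_smul' c B := by simp [fromBlocks_smul]

theorem dilation_apply (B : Matrix m n ℝ) : dilation B = fromBlocks 0 B Bᵀ 0 := rfl

theorem isHermitian_dilation (B : Matrix m n ℝ) : (dilation B).IsHermitian :=
  isHermitian_zero.fromBlocks B.conjTranspose_eq_transpose_of_trivial isHermitian_zero

variable [Fintype m] [Fintype n] [DecidableEq n]

theorem l2_opNorm_le_of_norm_mulVec_le {A : Matrix m n ℝ} {t : ℝ} (ht : 0 ≤ t)
    (h : ∀ x : EuclideanSpace ℝ n, ‖WithLp.toLp 2 (A *ᵥ x.ofLp)‖ ≤ t * ‖x‖) : ‖A‖ ≤ t :=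
  A.l2_opNorm_def ▸ ContinuousLinearMap.opNorm_le_bound _ ht h

variable [DecidableEq m]

theorem norm_le_norm_dilation (B : Matrix m n ℝ) : ‖B‖ ≤ ‖dilation B‖ := by
  refine l2_opNorm_le_of_norm_mulVec_le (norm_nonneg _) fun x ↦ ?_
  have := (dilation B).l2_opNorm_mulVec (WithLp.toLp 2 (Sum.elim 0 x.ofLp))
  simpa [dilation_apply, fromBlocks_mulVec, EuclideanSpace.norm_eq] using this

theorem dilation_single_sq (i : m) (j : n) (b : ℝ) :
    dilation (single i j b) ^ 2 =
      diagonal (Sum.elim (Pi.single i (b ^ 2)) (Pi.single j (b ^ 2))) := by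
  rw [sq, dilation_apply, fromBlocks_multiply]
  simp [← diagonal_single, sq, fromBlocks_diagonal]

theorem varianceProxy_dilation_single (π : m × n → ℝ) (B : Matrix m n ℝ) (s : Set (m × n)) :
    varianceProxy π (fun e ↦ dilation (single e.1 e.2 (B e.1 e.2))) s =
      diagonal (Sum.elim (fun i ↦ ∑ j, (s.indicator 1 (i, j) + π (i, j)) * B i j ^ 2)
        fun j ↦ ∑ i, (s.indicator 1 (i, j) + π (i, j)) * B i j ^ 2) := by
  simp only [varianceProxy, dilation_single_sq, ← diagonal_smul]
  ext a b
  rw [Matrix.sum_apply, Fintype.sum_prod_type]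
  rcases a with i | j <;> rcases b with i' | j' <;>
    simp [diagonal_apply, Pi.single_apply]

end Dilation

section MatrixConcentration

variable {m n : Type*}

/-- The matrix with entries `(1_{(i, j) ∈ s} - π (i, j)) * B i j`: the deviation of the sampled
matrix from its mean. -/
def centeredSample (π : m × n → ℝ) (B : Matrix m n ℝ) (s : Set (m × n)) : Matrix m n ℝ :=
  of fun i j ↦ (s.indicator 1 (i, j) - π (i, j)) * B i j

variable [Fintype m] [Fintype n] [DecidableEq n]

theorem centeredSample_eq_centeredSeries [DecidableEq m] (π : m × n → ℝ) (B : Matrix m n ℝ)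
    (s : Set (m × n)) :
    centeredSample π B s = centeredSeries π (fun e ↦ single e.1 e.2 (B e.1 e.2)) s := by
  ext i j
  simp [centeredSample, centeredSeries, Matrix.sum_apply, Fintype.sum_prod_type, single_apply,
    ite_and]

namespace IsIndepRandomSet

variable {S : Type*} [MeasurableSpace S] {P : Measure S} [IsProbabilityMeasure P]
  {π : m × n → ℝ} {Ω : S → Set (m × n)} {B : Matrix m n ℝ}

theorem integral_trace_dilation_centeredSample_pow_le [DecidableEq m]
    (h : IsIndepRandomSet P π Ω) {τ : ℝ} (hτ : 0 < τ) (hB : ∀ i j, B i j ^ 2 ≤ τ) {k : ℕ}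
    (hk : k ≠ 0) (hrow : ∀ i, ∑ j, π (i, j) * B i j ^ 2 ≤ k * τ)
    (hcol : ∀ j, ∑ i, π (i, j) * B i j ^ 2 ≤ k * τ) :
    ∫ ω, (dilation (centeredSample π B (Ω ω)) ^ (2 * k)).trace ∂P ≤
      (Fintype.card m + Fintype.card n) * (Real.exp 3 * (k ^ 2 * τ)) ^ k := by
  let d (s : Set (m × n)) : m ⊕ n → ℝ :=
    Sum.elim (fun i ↦ ∑ j, (s.indicator 1 (i, j) + π (i, j)) * B i j ^ 2)
      fun j ↦ ∑ i, (s.indicator 1 (i, j) + π (i, j)) * B i j ^ 2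
  have moment (a : m ⊕ n) : ∫ ω, d (Ω ω) a ^ k ∂P ≤ (Real.exp 3 * (k * τ)) ^ k := by
    rcases a with i | j
    · exact (h.preimage (Prod.mk_right_injective i)).integral_sum_indicator_add_mul_pow_le hτ
        (fun j ↦ sq_nonneg (B i j)) (hB i) (hrow i)
    · exact (h.preimage (Prod.mk_left_injective j)).integral_sum_indicator_add_mul_pow_le hτ
        (fun i ↦ sq_nonneg (B i j)) (hB · j) (hcol j)
  simp only [centeredSample_eq_centeredSeries, map_centeredSeries]
  calc _ ≤ k ^ k * ∫ ω, (varianceProxy π (fun e ↦ dilation (single e.1 e.2 (B e.1 e.2)))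
          (Ω ω) ^ k).trace ∂P :=
        h.integral_trace_centeredSeries_pow_le (fun e ↦ isHermitian_dilation _) hk
    _ = k ^ k * ∑ a, ∫ ω, d (Ω ω) a ^ k ∂P := by
        simp only [varianceProxy_dilation_single, diagonal_pow, trace_diagonal, Pi.pow_apply]
        rw [integral_finsetSum _ fun a _ ↦ h.integrable_comp fun s ↦ d s a ^ k]
    _ ≤ k ^ k * ∑ _a : m ⊕ n, (Real.exp 3 * (k * τ)) ^ k := by
        gcongr
        exact moment _
    _ = (Fintype.card m + Fintype.card n) * (Real.exp 3 * (k ^ 2 * τ)) ^ k := by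
        rw [Finset.sum_const, Finset.card_univ, Fintype.card_sum, nsmul_eq_mul, Nat.cast_add,
          mul_left_comm, ← mul_pow]
        ring_nf

theorem pow_mul_measureReal_lt_norm_centeredSample_le [DecidableEq m]
    (h : IsIndepRandomSet P π Ω) (B : Matrix m n ℝ) {T : ℝ} (hT : 0 ≤ T) {k : ℕ} (hk : k ≠ 0) :
    T ^ (2 * k) * P.real {ω | T < ‖centeredSample π B (Ω ω)‖} ≤
      ∫ ω, (dilation (centeredSample π B (Ω ω)) ^ (2 * k)).trace ∂P := by
  let Y (s : Set (m × n)) := dilation (centeredSample π B s)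
  have herm (s : Set (m × n)) : (Y s).IsHermitian := isHermitian_dilation _
  have trace_gt (ω : S) (hω : T < ‖centeredSample π B (Ω ω)‖) :
      T ^ (2 * k) ≤ (Y (Ω ω) ^ (2 * k)).trace := le_of_not_ge fun hle ↦ hω.not_ge
    ((norm_le_norm_dilation _).trans (norm_le_of_trace_pow_two_mul_le (herm _) hk hT hle))
  calc T ^ (2 * k) * P.real {ω | T < ‖centeredSample π B (Ω ω)‖}
      ≤ T ^ (2 * k) * P.real {ω | T ^ (2 * k) ≤ (Y (Ω ω) ^ (2 * k)).trace} :=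
        mul_le_mul_of_nonneg_left (measureReal_mono trace_gt) (by positivity)
    _ ≤ ∫ ω, (Y (Ω ω) ^ (2 * k)).trace ∂P := mul_meas_ge_le_integral_of_nonneg
        (ae_of_all P fun ω ↦ (posSemidef_pow_two_mul (herm _) k).trace_nonneg)
        (h.integrable_comp fun s ↦ (Y s ^ (2 * k)).trace) _

theorem measureReal_lt_norm_centeredSample_le (h : IsIndepRandomSet P π Ω) {L v : ℝ}
    (hL : 0 < L) (hv : 0 ≤ v) (hB : ∀ i j, |B i j| ≤ L)
    (hrow : ∀ i, ∑ j, π (i, j) * B i j ^ 2 ≤ v ^ 2)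
    (hcol : ∀ j, ∑ i, π (i, j) * B i j ^ 2 ≤ v ^ 2) {k : ℕ} (hk : k ≠ 0) :
    P.real {ω | Real.exp 3 * (k * L + √k * v) < ‖centeredSample π B (Ω ω)‖} ≤
      (Fintype.card m + Fintype.card n) * Real.exp (-(3 * k)) := by
  classical
  set T := Real.exp 3 * (k * L + √k * v) with hT
  have k_pos : (0 : ℝ) < k := by positivity
  have T_pos : 0 < T := by positivity
  let τ := L ^ 2 + v ^ 2 / k
  have k_mul_τ : k * τ = k * L ^ 2 + v ^ 2 := by
    rw [mul_add, mul_div_cancel₀ _ k_pos.ne']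
  have v_sq_le : v ^ 2 ≤ k * τ := k_mul_τ ▸ le_add_of_nonneg_left (by positivity)
  have B_sq_le (i : m) (j : n) : B i j ^ 2 ≤ τ :=
    (sq_le_sq.2 ((hB i j).trans (le_abs_self L))).trans
      (le_add_of_nonneg_right (by positivity))
  have sq_le : k ^ 2 * τ ≤ (k * L + √k * v) ^ 2 := by
    have cross : 0 ≤ k * L * (√k * v) := by positivity
    linear_combination 2 * cross + k * k_mul_τ - v ^ 2 * Real.sq_sqrt k_pos.le
  have exp_mul_sq : Real.exp 3 * (k * L + √k * v) ^ 2 = T ^ 2 * Real.exp (-3) := by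
    rw [hT, mul_pow, ← Real.exp_nat_mul, mul_right_comm, ← Real.exp_add]
    norm_num
  refine le_of_mul_le_mul_left ?_ (pow_pos T_pos (2 * k))
  calc T ^ (2 * k) * P.real {ω | T < ‖centeredSample π B (Ω ω)‖}
      ≤ (Fintype.card m + Fintype.card n) * (Real.exp 3 * (k ^ 2 * τ)) ^ k :=
        (h.pow_mul_measureReal_lt_norm_centeredSample_le B T_pos.le hk).trans
          (h.integral_trace_dilation_centeredSample_pow_le (by positivity) B_sq_le hk
            (fun i ↦ (hrow i).trans v_sq_le) fun j ↦ (hcol j).trans v_sq_le)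
    _ ≤ (Fintype.card m + Fintype.card n) * (Real.exp 3 * (k * L + √k * v) ^ 2) ^ k := by gcongr
    _ = T ^ (2 * k) * ((Fintype.card m + Fintype.card n) * Real.exp (-(3 * k))) := by
        rw [exp_mul_sq, mul_pow, ← pow_mul, ← Real.exp_nat_mul]
        ring_nf

end IsIndepRandomSet

end MatrixConcentration

section LowRankApproximation

variable {m n κ : Type*} [Fintype n]

theorem toLp_sum_smul_vecMulVec_mulVec (s : Finset κ) (c : κ → ℝ)
    (u : κ → EuclideanSpace ℝ m) (v : κ → EuclideanSpace ℝ n) (x : EuclideanSpace ℝ n) :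
    WithLp.toLp 2 ((∑ i ∈ s, c i • vecMulVec (u i).ofLp (v i).ofLp) *ᵥ x.ofLp) =
      ∑ i ∈ s, (c i * inner ℝ (v i) x) • u i := by
  ext a
  simp [sum_mulVec, smul_mulVec, vecMulVec_mulVec, EuclideanSpace.inner_eq_star_dotProduct,
    dotProduct_comm, Finset.sum_apply, mul_assoc]

theorem norm_toLp_sum_smul_vecMulVec_mulVec_sq [Fintype m] (s : Finset κ) (c : κ → ℝ)
    {u : κ → EuclideanSpace ℝ m} (hu : Orthonormal ℝ u) (v : κ → EuclideanSpace ℝ n)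
    (x : EuclideanSpace ℝ n) :
    ‖WithLp.toLp 2 ((∑ i ∈ s, c i • vecMulVec (u i).ofLp (v i).ofLp) *ᵥ x.ofLp)‖ ^ 2 =
      ∑ i ∈ s, (c i * inner ℝ (v i) x) ^ 2 := by
  rw [toLp_sum_smul_vecMulVec_mulVec, ← real_inner_self_eq_norm_sq, hu.inner_sum]
  simp only [conj_trivial, sq]

theorem norm_sum_smul_vecMulVec_le [Fintype m] [DecidableEq n] {s : Finset κ} {c : κ → ℝ}
    {u : κ → EuclideanSpace ℝ m} {v : κ → EuclideanSpace ℝ n} (hu : Orthonormal ℝ u)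
    (hv : Orthonormal ℝ v) {t : ℝ} (ht : 0 ≤ t) (hc : ∀ i ∈ s, |c i| ≤ t) :
    ‖∑ i ∈ s, c i • vecMulVec (u i).ofLp (v i).ofLp‖ ≤ t := by
  refine l2_opNorm_le_of_norm_mulVec_le ht fun x ↦ le_of_sq_le_sq ?_ (by positivity)
  calc ‖WithLp.toLp 2 ((∑ i ∈ s, c i • vecMulVec (u i).ofLp (v i).ofLp) *ᵥ x.ofLp)‖ ^ 2
      = ∑ i ∈ s, |c i| ^ 2 * ‖inner ℝ (v i) x‖ ^ 2 := by
        simp only [norm_toLp_sum_smul_vecMulVec_mulVec_sq s c hu, mul_pow, sq_abs,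
          Real.norm_eq_abs]
    _ ≤ ∑ i ∈ s, t ^ 2 * ‖inner ℝ (v i) x‖ ^ 2 := by
        gcongr with i hi
        exact hc i hi
    _ ≤ (t * ‖x‖) ^ 2 := by
        rw [← Finset.mul_sum, mul_pow]
        gcongr
        exact hv.sum_inner_products_le x

theorem exists_ne_zero_mulVec_eq_zero_inner_eq_zero [Finite m] [Fintype κ] {N : Matrix m n ℝ}
    (v : κ → EuclideanSpace ℝ n) (h : N.rank + Fintype.card κ < Fintype.card n) :
    ∃ x : EuclideanSpace ℝ n, x ≠ 0 ∧ N *ᵥ x.ofLp = 0 ∧ ∀ j, inner ℝ (v j) x = 0 := by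
  let T : EuclideanSpace ℝ n →ₗ[ℝ] LinearMap.range N.mulVecLin × (κ → ℝ) :=
    (N.mulVecLin.rangeRestrict ∘ₗ (WithLp.linearEquiv 2 ℝ (n → ℝ)).toLinearMap).prod
      (LinearMap.pi fun j ↦ (innerₛₗ ℝ (v j)))
  have hT : Module.finrank ℝ (LinearMap.range N.mulVecLin × (κ → ℝ)) <
      Module.finrank ℝ (EuclideanSpace ℝ n) := by
    simpa [Matrix.rank] using h
  obtain ⟨x, hx, hx0⟩ := (Submodule.ne_bot_iff _).1 (LinearMap.ker_ne_bot_of_finrank_lt (f := T) hT)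
  obtain ⟨hN, hv⟩ := Prod.ext_iff.1 hx
  exact ⟨x, hx0, congrArg Subtype.val hN, congrFun hv⟩

theorem rank_add_le [Finite m] (A B : Matrix m n ℝ) : (A + B).rank ≤ A.rank + B.rank := by
  unfold Matrix.rank
  rw [mulVecLin_add]
  exact (Submodule.finrank_mono (LinearMap.range_add_le _ _)).trans
    (Submodule.finrank_add_le_finrank_add_finrank _ _)

theorem rank_sum_vecMulVec_le [Finite m] (s : Finset κ) (u : κ → m → ℝ) (v : κ → n → ℝ) :
    (∑ i ∈ s, vecMulVec (u i) (v i)).rank ≤ s.card := by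
  classical
  induction s using Finset.induction_on with
  | empty => simp
  | insert a s ha ih =>
    rw [Finset.sum_insert ha, Finset.card_insert_of_notMem ha, add_comm]
    exact (rank_add_le _ _).trans (add_le_add ih (rank_vecMulVec_le _ _))

theorem sum_sq_le_rank_mul_norm_sq [Fintype m] [DecidableEq n] (Z : Matrix m n ℝ) :
    ∑ i, ∑ j, Z i j ^ 2 ≤ Z.rank * ‖Z‖ ^ 2 := by
  have hH : (Zᵀ * Z).IsHermitian := by
    simpa only [conjTranspose_eq_transpose_of_trivial] using isHermitian_conjTranspose_mul_self Z
  have hnorm : ‖Zᵀ * Z‖ = ‖Z‖ ^ 2 := by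
    rw [← conjTranspose_eq_transpose_of_trivial, l2_opNorm_conjTranspose_mul_self, sq]
  calc ∑ i, ∑ j, Z i j ^ 2 = (Zᵀ * Z).trace := by
        rw [Finset.sum_comm]
        simp only [trace, diag_apply, Matrix.mul_apply, transpose_apply, sq]
    _ = ∑ i with hH.eigenvalues i ≠ 0, hH.eigenvalues i := by
        rw [Finset.sum_filter_ne_zero]
        simpa using hH.trace_eq_sum_eigenvalues
    _ ≤ (Finset.univ.filter fun i ↦ hH.eigenvalues i ≠ 0).card • ‖Zᵀ * Z‖ := by
        refine Finset.sum_le_card_nsmul _ _ _ fun i _ ↦ ?_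
        rw [norm_eq_norm_eigenvalues hH]
        exact (le_abs_self _).trans (norm_le_pi_norm hH.eigenvalues i)
    _ = Z.rank * ‖Z‖ ^ 2 := by
        rw [hnorm, nsmul_eq_mul, ← rank_transpose_mul_self, hH.rank_eq_card_non_zero_eigs,
          Fintype.card_subtype]

end LowRankApproximation

section SingularValueDecomposition

variable {n : ℕ} {A : Matrix (Fin n) (Fin n) ℝ}

theorem SVD.norm_toLp_mulVec_sq (D : SVD A) (x : EuclideanSpace ℝ (Fin n)) :
    ‖WithLp.toLp 2 (A *ᵥ x.ofLp)‖ ^ 2 = ∑ i, (D.σ i * inner ℝ (D.v i) x) ^ 2 := by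
  conv_lhs => rw [D.eq_sum]
  exact norm_toLp_sum_smul_vecMulVec_mulVec_sq _ _ D.u.orthonormal _ _

theorem SVD.σ_le_norm_sub_of_rank_le (D : SVD A) {N : Matrix (Fin n) (Fin n) ℝ} {i : Fin n}
    (h : N.rank ≤ i) : D.σ i ≤ ‖A - N‖ := by
  have hcard : N.rank + Fintype.card (Finset.Ioi i) < Fintype.card (Fin n) := by
    simp only [Fintype.card_coe, Fin.card_Ioi, Fintype.card_fin]
    omega
  obtain ⟨x, hx, hNx, hvx⟩ := exists_ne_zero_mulVec_eq_zero_inner_eq_zero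
    (fun j : Finset.Ioi i ↦ D.v j) hcard
  have hle : ∀ j, (D.σ i * inner ℝ (D.v j) x) ^ 2 ≤ (D.σ j * inner ℝ (D.v j) x) ^ 2 := by
    intro j
    rcases lt_or_ge i j with hij | hji
    · simp [hvx ⟨j, Finset.mem_Ioi.2 hij⟩]
    · rw [mul_pow, mul_pow]
      gcongr
      exacts [D.σ_nonneg i, D.σ_antitone hji]
  have hσ : (D.σ i * ‖x‖) ^ 2 ≤ (‖A - N‖ * ‖x‖) ^ 2 := by
    calc (D.σ i * ‖x‖) ^ 2 = ∑ j, (D.σ i * inner ℝ (D.v j) x) ^ 2 := by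
          simp only [mul_pow, ← Finset.mul_sum, ← D.v.sum_sq_inner_right x]
      _ ≤ ∑ j, (D.σ j * inner ℝ (D.v j) x) ^ 2 := Finset.sum_le_sum fun j _ ↦ hle j
      _ = ‖WithLp.toLp 2 ((A - N) *ᵥ x.ofLp)‖ ^ 2 := by
          rw [sub_mulVec, hNx, sub_zero, D.norm_toLp_mulVec_sq]
      _ ≤ (‖A - N‖ * ‖x‖) ^ 2 := by
          gcongr
          exact (A - N).l2_opNorm_mulVec x
  exact le_of_mul_le_mul_right (le_of_sq_le_sq hσ (by positivity)) (norm_pos_iff.2 hx)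

theorem SVD.norm_sub_sum_le_of_rank_le (D : SVD A) {N : Matrix (Fin n) (Fin n) ℝ} {r : ℕ}
    (h : N.rank ≤ r) :
    ‖A - ∑ i : Fin n with i.val < r, D.σ i • vecMulVec (D.u i).ofLp (D.v i).ofLp‖ ≤
      ‖A - N‖ := by
  have htail : A - ∑ i : Fin n with i.val < r, D.σ i • vecMulVec (D.u i).ofLp (D.v i).ofLp =
      ∑ i : Fin n with ¬ i.val < r, D.σ i • vecMulVec (D.u i).ofLp (D.v i).ofLp := by
    conv_lhs => enter [1]; rw [D.eq_sum]
    rw [sub_eq_iff_eq_add', Finset.sum_filter_add_sum_filter_not]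
  rw [htail]
  refine norm_sum_smul_vecMulVec_le D.u.orthonormal D.v.orthonormal (norm_nonneg _) fun i hi ↦ ?_
  rw [abs_of_nonneg (D.σ_nonneg i)]
  exact D.σ_le_norm_sub_of_rank_le (h.trans (not_lt.1 (Finset.mem_filter.1 hi).2))

theorem SVD.rank_proj_le (D : SVD A) (p : ℝ) (r : ℕ) : (D.proj p r).rank ≤ r := by
  have hcard : (Finset.univ.filter fun i : Fin n ↦ i.val < r).card ≤ r := by
    simp [Fin.card_filter_val_lt]
  simp only [SVD.proj, Finset.smul_sum, smul_smul, ← smul_vecMulVec]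
  exact (rank_sum_vecMulVec_le _ _ _).trans hcard

theorem SVD.norm_sub_proj_le (D : SVD A) {M : Matrix (Fin n) (Fin n) ℝ} {p : ℝ} (hp : 0 < p) :
    ‖M - D.proj p M.rank‖ ≤ 2 * ‖(1 / p) • A - M‖ := by
  have hrank : (p • M).rank ≤ M.rank :=
    (rank_smul_of_mem_nonZeroDivisors _ (mem_nonZeroDivisors_of_ne_zero hp.ne')).le
  have hscale : (1 / p) • (A - p • M) = (1 / p) • A - M := by
    rw [smul_sub, smul_smul, one_div_mul_cancel hp.ne', one_smul]
  have hproj : ‖(1 / p) • A - D.proj p M.rank‖ ≤ ‖(1 / p) • A - M‖ := by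
    rw [SVD.proj, ← smul_sub, ← hscale, norm_smul, norm_smul]
    gcongr
    exact D.norm_sub_sum_le_of_rank_le hrank
  calc ‖M - D.proj p M.rank‖
      ≤ ‖M - (1 / p) • A‖ + ‖(1 / p) • A - D.proj p M.rank‖ :=
        norm_sub_le_norm_sub_add_norm_sub _ _ _
    _ ≤ ‖(1 / p) • A - M‖ + ‖(1 / p) • A - M‖ := by
        rw [norm_sub_rev]
        gcongr
    _ = 2 * ‖(1 / p) • A - M‖ := (two_mul _).symm

theorem frobNorm_le_sqrt_rank_mul_norm (Z : Matrix (Fin n) (Fin n) ℝ) :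
    frobNorm Z ≤ √Z.rank * ‖Z‖ := by
  refine (Real.sqrt_le_sqrt (sum_sq_le_rank_mul_norm_sq Z)).trans_eq ?_
  rw [Real.sqrt_mul (Nat.cast_nonneg _), Real.sqrt_sq (norm_nonneg _)]

theorem SVD.frobNorm_sub_proj_le (D : SVD A) {M : Matrix (Fin n) (Fin n) ℝ} {p : ℝ}
    (hp : 0 < p) :
    frobNorm (M - D.proj p M.rank) ≤ 3 * √M.rank * ‖(1 / p) • A - M‖ := by
  have hrank : (M - D.proj p M.rank).rank ≤ 2 * M.rank := by
    have hneg : ((-1 : ℝ) • D.proj p M.rank).rank ≤ M.rank :=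
      (rank_smul_of_mem_nonZeroDivisors _
        (mem_nonZeroDivisors_of_ne_zero (neg_ne_zero.2 one_ne_zero))).trans_le
        (D.rank_proj_le p M.rank)
    rw [sub_eq_add_neg, ← neg_one_smul ℝ, two_mul]
    exact (rank_add_le _ _).trans (add_le_add_right hneg _)
  have hsqrt : √((M - D.proj p M.rank).rank : ℝ) * 2 ≤ 3 * √M.rank := by
    refine le_of_sq_le_sq ?_ (by positivity)
    rw [mul_pow, mul_pow, Real.sq_sqrt (Nat.cast_nonneg _), Real.sq_sqrt (Nat.cast_nonneg _)]
    have : ((M - D.proj p M.rank).rank : ℝ) ≤ 2 * M.rank := mod_cast hrank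
    have : (0 : ℝ) ≤ M.rank := Nat.cast_nonneg _
    linarith
  calc frobNorm (M - D.proj p M.rank)
      ≤ √(M - D.proj p M.rank).rank * ‖M - D.proj p M.rank‖ := frobNorm_le_sqrt_rank_mul_norm _
    _ ≤ √(M - D.proj p M.rank).rank * (2 * ‖(1 / p) • A - M‖) := by
        gcongr
        exact D.norm_sub_proj_le hp
    _ ≤ 3 * √M.rank * ‖(1 / p) • A - M‖ := by
        rw [← mul_assoc]
        gcongr

end SingularValueDecomposition

section Recovery

variable {n : ℕ}

theorem abs_le_maxNorm (M : Matrix (Fin n) (Fin n) ℝ) (i j : Fin n) : |M i j| ≤ maxNorm M :=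
  (le_ciSup (f := fun j ↦ |M i j|) (Set.finite_range _).bddAbove j).trans
    (le_ciSup (f := fun i ↦ ⨆ j, |M i j|) (Set.finite_range _).bddAbove i)

theorem maxNorm_pos {M : Matrix (Fin n) (Fin n) ℝ} (hM : M ≠ 0) : 0 < maxNorm M := by
  contrapose! hM
  ext i j
  exact abs_nonpos_iff.1 ((abs_le_maxNorm M i j).trans hM)

theorem maxRowColNorm_nonneg (M : Matrix (Fin n) (Fin n) ℝ) : 0 ≤ maxRowColNorm M :=
  le_max_of_le_left (Real.iSup_nonneg fun _ ↦ Real.sqrt_nonneg _)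

theorem sum_row_sq_le_maxRowColNorm_sq (M : Matrix (Fin n) (Fin n) ℝ) (i : Fin n) :
    ∑ j, M i j ^ 2 ≤ maxRowColNorm M ^ 2 :=
  (Real.sqrt_le_left (maxRowColNorm_nonneg M)).1 <|
    (le_ciSup (f := fun i ↦ √(∑ b, M i b ^ 2)) (Set.finite_range _).bddAbove i).trans
      (le_max_left _ _)

theorem sum_col_sq_le_maxRowColNorm_sq (M : Matrix (Fin n) (Fin n) ℝ) (j : Fin n) :
    ∑ i, M i j ^ 2 ≤ maxRowColNorm M ^ 2 :=
  (Real.sqrt_le_left (maxRowColNorm_nonneg M)).1 <|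
    (le_ciSup (f := fun j ↦ √(∑ a, M a j ^ 2)) (Set.finite_range _).bddAbove j).trans
      (le_max_right _ _)

theorem rowDegree_observe_le (s : Set (Fin n × Fin n)) (M : Matrix (Fin n) (Fin n) ℝ)
    (i : Fin n) : (rowDegree (observe s M) i : ℝ) ≤ ∑ j, s.indicator 1 (i, j) := by
  classical
  simp only [rowDegree, observe, of_apply, Set.indicator_apply, Pi.one_apply, Finset.sum_boole]
  exact mod_cast Finset.card_le_card <|
    Finset.monotone_filter_right _ fun _ _ h ↦ (ite_ne_right_iff.1 h).1

theorem colDegree_observe_le (s : Set (Fin n × Fin n)) (M : Matrix (Fin n) (Fin n) ℝ)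
    (j : Fin n) : (colDegree (observe s M) j : ℝ) ≤ ∑ i, s.indicator 1 (i, j) := by
  classical
  simp only [colDegree, observe, of_apply, Set.indicator_apply, Pi.one_apply, Finset.sum_boole]
  exact mod_cast Finset.card_le_card <|
    Finset.monotone_filter_right _ fun _ _ h ↦ (ite_ne_right_iff.1 h).1

theorem trim_eq_self {p : ℝ} {A : Matrix (Fin n) (Fin n) ℝ}
    (hrow : ∀ i, rowDegree A i ≤ 2 * p * n) (hcol : ∀ j, colDegree A j ≤ 2 * p * n) :
    trim p A = A := by
  ext i j
  exact if_neg (not_or.2 ⟨(hrow i).not_gt, (hcol j).not_gt⟩)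

theorem one_div_smul_observe_sub {p : ℝ} (hp : p ≠ 0) (s : Set (Fin n × Fin n))
    (M : Matrix (Fin n) (Fin n) ℝ) :
    (1 / p) • observe s M - M = (1 / p) • centeredSample (fun _ ↦ p) M s := by
  classical
  ext i j
  simp only [observe, centeredSample, Set.indicator_apply, Pi.one_apply, Matrix.sub_apply,
    Matrix.smul_apply, of_apply, smul_eq_mul]
  split_ifs
  · field_simp
  · field_simp
    ring

theorem frobNorm_sub_proj_le_norm_centeredSample {p : ℝ} (hp : 0 < p) {s : Set (Fin n × Fin n)}
    {M : Matrix (Fin n) (Fin n) ℝ} (hrow : ∀ i, ∑ j, s.indicator 1 (i, j) ≤ 2 * p * n)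
    (hcol : ∀ j, ∑ i, s.indicator 1 (i, j) ≤ 2 * p * n) (D : SVD (trim p (observe s M))) :
    frobNorm (M - D.proj p M.rank) ≤ 3 * √M.rank * (‖centeredSample (fun _ ↦ p) M s‖ / p) := by
  have htrim : trim p (observe s M) = observe s M :=
    trim_eq_self (fun i ↦ (rowDegree_observe_le s M i).trans (hrow i))
      fun j ↦ (colDegree_observe_le s M j).trans (hcol j)
  have hnorm : ‖(1 / p) • trim p (observe s M) - M‖ = ‖centeredSample (fun _ ↦ p) M s‖ / p := by
    rw [htrim, one_div_smul_observe_sub hp.ne', norm_smul, Real.norm_of_nonneg (by positivity),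
      one_div_mul_eq_div]
  exact hnorm ▸ D.frobNorm_sub_proj_le hp

variable {S : Type*} [MeasurableSpace S] {P : Measure S} {p : ℝ} {Om : S → Set (Fin n × Fin n)}

namespace IsBernoulliSample

theorem isIndepRandomSet (h : IsBernoulliSample P p Om) : IsIndepRandomSet P (fun _ ↦ p) Om :=
  ⟨h.measurableSet_mem, h.indep, h.prob⟩

variable [IsProbabilityMeasure P]

theorem measureReal_exists_two_mul_lt_sum_indicator_le (h : IsBernoulliSample P p Om)
    {f : Fin n → Fin n → Fin n × Fin n} (hf : ∀ i, (f i).Injective) :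
    P.real {ω | ∃ i, 2 * p * n < ∑ j, (Om ω).indicator 1 (f i j)} ≤
      n * Real.exp (-(p * n) / 4) := by
  have hline (i : Fin n) : P.real {ω | 2 * p * n < ∑ j, (Om ω).indicator 1 (f i j)} ≤
      Real.exp (-(p * n) / 4) := by
    have chernoff : P.real {ω | 2 * ∑ _j : Fin n, p < ∑ j, (Om ω).indicator 1 (f i j)} ≤
        Real.exp (-(∑ _j : Fin n, p) / 4) :=
      (h.isIndepRandomSet.preimage (hf i)).measureReal_two_mul_sum_lt_le Finset.univ
    simpa [mul_comm p, mul_assoc] using chernoff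
  calc P.real {ω | ∃ i, 2 * p * n < ∑ j, (Om ω).indicator 1 (f i j)}
      = P.real (⋃ i, {ω | 2 * p * n < ∑ j, (Om ω).indicator 1 (f i j)}) := by
        rw [Set.ofPred_exists]
    _ ≤ ∑ i : Fin n, P.real {ω | 2 * p * n < ∑ j, (Om ω).indicator 1 (f i j)} :=
        measureReal_iUnion_fintype_le _
    _ ≤ ∑ _i : Fin n, Real.exp (-(p * n) / 4) := Finset.sum_le_sum fun i _ ↦ hline i
    _ = n * Real.exp (-(p * n) / 4) := by simp

theorem measureReal_lt_norm_centeredSample_le (h : IsBernoulliSample P p Om)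
    {M : Matrix (Fin n) (Fin n) ℝ} (hM : M ≠ 0) (hp : 0 ≤ p) {k : ℕ} (hk : k ≠ 0) :
    P.real {ω | Real.exp 3 * (k * maxNorm M + √k * (√p * maxRowColNorm M)) <
        ‖centeredSample (fun _ ↦ p) M (Om ω)‖} ≤ 2 * n * Real.exp (-(3 * k)) := by
  have hvar : (√p * maxRowColNorm M) ^ 2 = p * maxRowColNorm M ^ 2 := by
    rw [mul_pow, Real.sq_sqrt hp]
  have := h.isIndepRandomSet.measureReal_lt_norm_centeredSample_le (maxNorm_pos hM)
    (mul_nonneg (Real.sqrt_nonneg p) (maxRowColNorm_nonneg M)) (abs_le_maxNorm M)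
    (fun i ↦ by
      rw [hvar, ← Finset.mul_sum]
      exact mul_le_mul_of_nonneg_left (sum_row_sq_le_maxRowColNorm_sq M i) hp)
    (fun j ↦ by
      rw [hvar, ← Finset.mul_sum]
      exact mul_le_mul_of_nonneg_left (sum_col_sq_le_maxRowColNorm_sq M j) hp) hk
  simpa only [Fintype.card_fin, ← two_mul] using this

theorem le_measureReal_frobNorm_sub_proj_le (h : IsBernoulliSample P p Om)
    {M : Matrix (Fin n) (Fin n) ℝ} (hM : M ≠ 0) (hp : 0 < p) {k : ℕ} (hk : k ≠ 0) :
    1 - 2 * n * (Real.exp (-(3 * k)) + Real.exp (-(p * n) / 4)) ≤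
      P.real {ω | ∀ D : SVD (trim p (observe (Om ω) M)), frobNorm (M - D.proj p M.rank) ≤
        3 * √M.rank *
          (Real.exp 3 * (k * maxNorm M + √k * (√p * maxRowColNorm M)) / p)} := by
  set T := Real.exp 3 * (k * maxNorm M + √k * (√p * maxRowColNorm M))
  set good := {ω | ∀ D : SVD (trim p (observe (Om ω) M)),
    frobNorm (M - D.proj p M.rank) ≤ 3 * √M.rank * (T / p)}
  set large := {ω | T < ‖centeredSample (fun _ ↦ p) M (Om ω)‖}
  set rows := {ω | ∃ i, 2 * p * n < ∑ j, (Om ω).indicator 1 (i, j)}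
  set cols := {ω | ∃ j, 2 * p * n < ∑ i, (Om ω).indicator 1 (i, j)}
  have hcover : Set.univ ⊆ good ∪ (large ∪ (rows ∪ cols)) := by
    intro ω _
    by_contra hω
    simp only [Set.mem_union, not_or] at hω
    obtain ⟨hgood, hlarge, hrows, hcols⟩ := hω
    refine hgood fun D ↦ (frobNorm_sub_proj_le_norm_centeredSample hp ?_ ?_ D).trans ?_
    · exact fun i ↦ not_lt.1 fun hi ↦ hrows ⟨i, hi⟩
    · exact fun j ↦ not_lt.1 fun hj ↦ hcols ⟨j, hj⟩
    · gcongr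
      exact not_lt.1 hlarge
  have hlarge : P.real large ≤ 2 * n * Real.exp (-(3 * k)) :=
    h.measureReal_lt_norm_centeredSample_le hM hp.le hk
  have hrows : P.real rows ≤ n * Real.exp (-(p * n) / 4) :=
    h.measureReal_exists_two_mul_lt_sum_indicator_le Prod.mk_right_injective
  have hcols : P.real cols ≤ n * Real.exp (-(p * n) / 4) :=
    h.measureReal_exists_two_mul_lt_sum_indicator_le Prod.mk_left_injective
  have : 1 ≤ P.real good + (P.real large + (P.real rows + P.real cols)) :=
    calc 1 = P.real Set.univ := probReal_univ.symm
      _ ≤ P.real (good ∪ (large ∪ (rows ∪ cols))) := measureReal_mono hcover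
      _ ≤ P.real good + (P.real large + (P.real rows + P.real cols)) := by
        grw [measureReal_union_le, measureReal_union_le, measureReal_union_le]
  linarith

end IsBernoulliSample

theorem exists_nat_log_le_le_three_mul_log (hn : 2 ≤ n) :
    ∃ k : ℕ, k ≠ 0 ∧ Real.log n ≤ k ∧ k ≤ 3 * Real.log n := by
  have hlog : 1 / 2 ≤ Real.log n := by
    have : Real.log 2 ≤ Real.log n := Real.log_le_log (by norm_num) (mod_cast hn)
    linarith [Real.log_two_gt_d9]
  refine ⟨⌈Real.log n⌉₊, (Nat.ceil_pos.2 (by linarith)).ne', Nat.le_ceil _, ?_⟩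
  linarith [Nat.ceil_lt_add_one (show 0 ≤ Real.log n by linarith)]

theorem two_mul_mul_exp_add_exp_le (hn : n ≠ 0) {k : ℕ} (hk : Real.log n ≤ k)
    (hp : 8 * (Real.log n / n) ≤ p) :
    2 * n * (Real.exp (-(3 * k)) + Real.exp (-(p * n) / 4)) ≤ 4 / n := by
  have hn0 : (0 : ℝ) < n := by positivity
  have hpn : 8 * Real.log n ≤ p * n := by rwa [← mul_div_assoc, div_le_iff₀ hn0] at hp
  have hexp : Real.exp (-(2 * Real.log n)) = ((n : ℝ) ^ 2)⁻¹ := by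
    rw [Real.exp_neg, two_mul, Real.exp_add, Real.exp_log hn0, sq]
  calc 2 * n * (Real.exp (-(3 * k)) + Real.exp (-(p * n) / 4))
      ≤ 2 * n * (Real.exp (-(2 * Real.log n)) + Real.exp (-(2 * Real.log n))) := by
        gcongr
        · linarith [Real.log_natCast_nonneg n]
        · linarith
    _ = 4 / n := by
        rw [hexp]
        field_simp
        norm_num

theorem three_mul_sqrt_mul_le {r k l L V : ℝ} (hr : 0 ≤ r) (hp : 0 < p) (hL : 0 ≤ L)
    (hV : 0 ≤ V) (hl : 0 ≤ l) (hk : k ≤ 3 * l) :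
    3 * √r * (Real.exp 3 * (k * L + √k * (√p * V)) / p) ≤
      9 * Real.exp 3 * (√r * l / p * L + √(r * l / p) * V) := by
  have hsqrt : √k ≤ 3 * √l := by
    rw [← Real.sqrt_sq (zero_le_three), ← Real.sqrt_mul (by norm_num)]
    exact Real.sqrt_le_sqrt (by linarith)
  have hsplit : √(r * l / p) = √r * (√l * √p / p) := by
    rw [mul_div_assoc √l, Real.sqrt_div_self', Real.sqrt_div' _ hp.le, Real.sqrt_mul hr]
    ring
  calc 3 * √r * (Real.exp 3 * (k * L + √k * (√p * V)) / p)
      ≤ 3 * √r * (Real.exp 3 * (3 * l * L + 3 * √l * (√p * V)) / p) := by gcongr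
    _ = 9 * Real.exp 3 * (√r * l / p * L + √(r * l / p) * V) := by
        rw [hsplit]
        ring

end Recovery

end SVDProjection

end

theorem corollary1 :
    ∃ c₀ > (0 : ℝ), ∃ c' > (0 : ℝ), ∃ c₁ > (0 : ℝ), ∃ c₂ > (0 : ℝ),
      ∀ (n : ℕ), 1 ≤ n →
      ∀ (r : ℕ) (M : Matrix (Fin n) (Fin n) ℝ), M.rank = r →
      ∀ (p : ℝ), 0 < p → p ≤ 1 → c₀ * (Real.log n / n) ≤ p →
      ∀ (S : Type*) [MeasurableSpace S] (P : MeasureTheory.Measure S)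
        [MeasureTheory.IsProbabilityMeasure P] (Om : S → Set (Fin n × Fin n)),
        SVDProjection.IsBernoulliSample P p Om →
        1 - c₁ * (n : ℝ) ^ (-c₂) ≤
          P.real {ω | ∀ D : SVDProjection.SVD
              (SVDProjection.trim p (SVDProjection.observe (Om ω) M)),
            SVDProjection.frobNorm (M - D.proj p r) ≤
              c' * (√r * Real.log n / p * SVDProjection.maxNorm M +
                √(r * Real.log n / p) * SVDProjection.maxRowColNorm M)} := by
  refine ⟨8, by norm_num, 9 * Real.exp 3, by positivity, 4, by norm_num, 1, by norm_num, ?_⟩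
  rintro n hn r M rfl p hp0 - hp S _ P _ Om hOm
  rw [Real.rpow_neg_one, ← div_eq_mul_inv]
  obtain rfl | hn2 := hn.eq_or_lt
  · exact (by norm_num : 1 - 4 / ((1 : ℕ) : ℝ) ≤ 0).trans MeasureTheory.measureReal_nonneg
  by_cases hM : M = 0
  · simp [hM, SVDProjection.SVD.proj, SVDProjection.frobNorm, div_nonneg]
  obtain ⟨k, hk0, hlog, hk3⟩ := SVDProjection.exists_nat_log_le_le_three_mul_log hn2
  have hfail := SVDProjection.two_mul_mul_exp_add_exp_le (by omega : n ≠ 0) hlog hp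
  refine le_trans (by linarith) ((hOm.le_measureReal_frobNorm_sub_proj_le hM hp0 hk0).trans
    (MeasureTheory.measureReal_mono fun ω hω D ↦ (hω D).trans ?_))
  exact SVDProjection.three_mul_sqrt_mul_le (Nat.cast_nonneg _) hp0
    (SVDProjection.maxNorm_pos hM).le (SVDProjection.maxRowColNorm_nonneg M)
    (Real.log_natCast_nonneg n) hk3
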